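/- Let $X\in\mathbb R^{n\times p}$, and let $\|\cdot\|$ denote the Euclidean norm of a vector, $\|\cdot\|_F$ the Frobenius norm, $\|T\|_{2,1}=\sum_{j}\|T_{j*}\|$ the sum of the Euclidean norms of the rows of $T$, $X_{*j}$ the $j$-th column of $X$, and $X_{*J}$ the submatrix of the columns with index in $J$. For $1\le k\le p$ define the $k$-sparse Riesz constants $\kappa_\pm(k)\ge 0$ of $X$ by $$\kappa_-^2(k)=\min_{|J|=k}\sigma_{\min}(X_{*J}'X_{*J}),\qquad \kappa_+^2(k)=\max_{|J|=k}\sigma_{\max}(X_{*J}'X_{*J}),$$ where $J$ ranges over the subsets of $\{1,\dots,p\}$ and $\sigma_{\min},\sigma_{\max}$ are the smallest and the largest singular value of a $k\times k$ matrix. Suppose that, for a positive integer $s_*$ with $2s_*\le p$ and real numbers $c_*>0$ and $K>1$, $X$ satisfies the sparse eigenvalue condition $$K^{-1}\le\kappa_-(s_*)\le\kappa_+(s_*)\le K,\qquad \frac{\kappa_+^2(s_*)-\kappa_-^2(2s_*)}{\kappa_-^2(s_*)}<c_*.$$ Consider the linear model $W=XB+Z$, where $W\in\mathbb R^{n\times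 r}$ is the response matrix, $Z\in\mathbb R^{n\times r}$ is the error matrix, and $B\in\mathbb R^{p\times r}$ has at most $s$ nonzero rows, for some integer $s\ge 1$. Suppose that $s_*\ge 2s$ and $6c_*\le\sqrt{s_*/s-1}$. For a penalty level $\lambda>0$ let $\hat B$ be a group Lasso estimator, that is, any minimizer $$\hat B\in\operatorname*{argmin}_{T\in\mathbb R^{p\times r}}\ \tfrac12\|W-XT\|_F^2+\lambda\|T\|_{2,1}.$$ (i) If $2\|X_{*j}'(W-XB)\|\le\lambda$ for all $j=1,\dots,p$, then $$\|\hat B-B\|_F\le\frac{3\,(1+(4c_*)^{-1})}{\kappa_-^2(s_*)}\,\sqrt{s}\,\lambda.\qquad(*)$$ (ii) If $Z$ has i.i.d. $N(0,\sigma^2)$ entries, $\eta\in(0,1)$, and $$\lambda\ge 2\sigma\max_{1\le j\le p}\|X_{*j}\|\,\bigl(\sqrt r+\sqrt{2\log(p/\eta)}\bigr),$$ then $(*)$ holds with probability at least $1-\eta$. -/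

import Mathlib

open MeasureTheory ProbabilityTheory

/- The norm on matrices is the Frobenius norm. -/
attribute [local instance] Matrix.frobeniusNormedAddCommGroup

/-- The Euclidean norm of a real vector. -/
noncomputable def vecNorm {ι : Type*} [Fintype ι] (v : ι → ℝ) : ℝ :=
  ‖(WithLp.toLp 2 v : EuclideanSpace ℝ ι)‖

/-- The `ℓ₂/ℓ₁` norm of a matrix: the sum of the Euclidean norms of its rows. -/
noncomputable def norm21 {p r : ℕ} (B : Matrix (Fin p) (Fin r) ℝ) : ℝ :=
  ∑ j, vecNorm (B.row j)

/-- The index set of the nonzero rows of a matrix. -/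
def rowSupport {p r : ℕ} (B : Matrix (Fin p) (Fin r) ℝ) : Set (Fin p) :=
  {j | B.row j ≠ 0}

/-- The submatrix `X_{*T}` formed by the columns of `X` with index in `T`. -/
def colSubmatrix {n p : ℕ} (X : Matrix (Fin n) (Fin p) ℝ) (T : Finset (Fin p)) :
    Matrix (Fin n) T ℝ :=
  X.submatrix id (fun j : T => (j : Fin p))

/-- The Gram matrix `X_{*T}' X_{*T}`. -/
def gramOn {n p : ℕ} (X : Matrix (Fin n) (Fin p) ℝ) (T : Finset (Fin p)) : Matrix T T ℝ :=
  (colSubmatrix X T).transpose * colSubmatrix X T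

/-- The largest singular value of a square matrix. Mathlib numbers the singular values in
decreasing order, starting from `0`. -/
noncomputable def sigmaMax {ι : Type*} [Fintype ι] [DecidableEq ι] (G : Matrix ι ι ℝ) : ℝ :=
  (Matrix.toEuclideanLin G).singularValues 0

/-- The smallest singular value of a square matrix (the last of its `card ι` singular values,
which is `0` if the matrix is singular). -/
noncomputable def sigmaMin {ι : Type*} [Fintype ι] [DecidableEq ι] (G : Matrix ι ι ℝ) : ℝ :=
  (Matrix.toEuclideanLin G).singularValues (Fintype.card ι - 1)

/-- The lower `k`-sparse Riesz constant `κ₋(k)` of `X`, used for `1 ≤ k ≤ p`: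
`κ₋(k)²` is the minimum of `σ_min(X_{*T}' X_{*T})` over the sets `T` of `k` columns. -/
noncomputable def kappaMinus {n p : ℕ} (X : Matrix (Fin n) (Fin p) ℝ) (k : ℕ) : ℝ :=
  √(⨅ T : {T : Finset (Fin p) // T.card = k}, sigmaMin (gramOn X T.1))

/-- The upper `k`-sparse Riesz constant `κ₊(k)` of `X`, used for `1 ≤ k ≤ p`:
`κ₊(k)²` is the maximum of `σ_max(X_{*T}' X_{*T})` over the sets `T` of `k` columns. -/
noncomputable def kappaPlus {n p : ℕ} (X : Matrix (Fin n) (Fin p) ℝ) (k : ℕ) : ℝ :=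
  √(⨆ T : {T : Finset (Fin p) // T.card = k}, sigmaMax (gramOn X T.1))

/-- The sparse eigenvalue condition for `X` with the constants `s_*`, `c_*` and `K`. The
inequality `2 s_* ≤ p` says that the sparse Riesz constants it involves are defined. -/
structure SparseEigenvalueCondition {n p : ℕ} (X : Matrix (Fin n) (Fin p) ℝ)
    (sStar : ℕ) (cStar K : ℝ) : Prop where
  sStar_pos : 0 < sStar
  two_mul_sStar_le : 2 * sStar ≤ p
  cStar_pos : 0 < cStar
  one_le_K : 1 ≤ K
  inv_K_le : K⁻¹ ≤ kappaMinus X sStar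
  kappaMinus_le : kappaMinus X sStar ≤ kappaPlus X sStar
  kappaPlus_le : kappaPlus X sStar ≤ K
  ratio_lt :
    (kappaPlus X sStar ^ 2 - kappaMinus X (2 * sStar) ^ 2) / kappaMinus X sStar ^ 2 < cStar

/-- The group Lasso objective `‖W - X T‖_F² / 2 + lam ‖T‖_{2,1}`. -/
noncomputable def groupLassoObjective {n p r : ℕ} (X : Matrix (Fin n) (Fin p) ℝ)
    (W : Matrix (Fin n) (Fin r) ℝ) (lam : ℝ) (T : Matrix (Fin p) (Fin r) ℝ) : ℝ :=
  ‖W - X * T‖ ^ 2 / 2 + lam * norm21 T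

/-- `Bhat` is a group Lasso estimator: a minimiser of the group Lasso objective over all real
`p × r` matrices. -/
def IsGroupLasso {n p r : ℕ} (X : Matrix (Fin n) (Fin p) ℝ)
    (W : Matrix (Fin n) (Fin r) ℝ) (lam : ℝ) (Bhat : Matrix (Fin p) (Fin r) ℝ) : Prop :=
  ∀ T : Matrix (Fin p) (Fin r) ℝ,
    groupLassoObjective X W lam Bhat ≤ groupLassoObjective X W lam T

/-! Let `D = Bhat - B`, let `d j` be its row norms, and let `H i j` be the `(i, j)` entry of `X'X`
times the inner product of rows `i` and `j` of `D`. A sum of `H` over `A × A` is then the squared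
norm of `X` applied to the rows of `D` in `A`. Moving row `j` of `Bhat` to that of `B` and using
optimality bounds each row sum of `H` by `3/2 * lam * d j` on a set `S` of `s` rows carrying `B`,
and by `-1/2 * lam * d j` off it. As the total of `H` is nonnegative, `d` lies in the cone `∑ off S
≤ 3 * ∑ on S`.

Join to `S` the `m = s_* - s` largest remaining rows, giving `A`, with `a` the `ℓ₂` norm of `d` on
`A`. The sparse eigenvalue bound gives `κ₋² a² ≤ H(A, A)`, which is the row sums over `A` minus the
cross term with the complement. The complement is cut into blocks of decreasing `d`
(`sum_le_of_forall_block_le`). Each block is nearly orthogonal to `A` (`neg_le_sum_sum_rowGram`),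
and the cone and the bound on `c_*` let the cross term absorb at most half of `κ₋² a²`. This bounds
`a`. The remaining rows are at most `a / (4c_*)` in `ℓ₂` norm. This is
`sqrt_sum_sq_le_of_restricted`.

For Gaussian noise, each `X_j'Z` has independent centred Gaussian entries. A chi-square Chernoff
bound and a union bound over columns give the noise condition. -/

/-! ### Block decomposition and the abstract error bound -/

theorem Finset.exists_subset_card_eq_forall_le {ι : Type*} [DecidableEq ι] (f : ι → ℝ)
    (T : Finset ι) (m : ℕ) (hm : m ≤ T.card) :
    ∃ A ⊆ T, A.card = m ∧ ∀ a ∈ A, ∀ b ∈ T \ A, f b ≤ f a := by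
  induction m with
  | zero => exact ⟨∅, by simp, by simp, by simp⟩
  | succ m ih =>
    obtain ⟨A, hAT, hAm, hA⟩ := ih (by omega)
    have hne : (T \ A).Nonempty := by
      rw [← Finset.card_pos, Finset.card_sdiff_of_subset hAT]; omega
    obtain ⟨x, hx, hmax⟩ := Finset.exists_max_image (T \ A) f hne
    obtain ⟨hxT, hxA⟩ := Finset.mem_sdiff.1 hx
    refine ⟨insert x A, Finset.insert_subset hxT hAT, by simp [hxA, hAm], ?_⟩
    intro a ha b hb
    have hb' : b ∈ T \ A := by
      simp only [Finset.mem_sdiff, Finset.mem_insert, not_or] at hb ⊢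
      exact ⟨hb.1, hb.2.2⟩
    rcases Finset.mem_insert.1 ha with rfl | ha
    · exact hmax b hb'
    · exact hA a ha b hb'

/-- If the sum of `h` over every block of at most `m` indices is at most `C` times the `ℓ₂` norm of
`f` over the block, then the sum over `T` is controlled by the `ℓ₁` norm of `f` over `T`. -/
theorem sum_le_of_forall_block_le {ι : Type*} [DecidableEq ι] (f h : ι → ℝ)
    (hf : ∀ i, 0 ≤ f i) (m : ℕ) (hm : 1 ≤ m) (C : ℝ) (hC : 0 ≤ C) (T : Finset ι)
    (hblock : ∀ A ⊆ T, A.card ≤ m → ∑ i ∈ A, h i ≤ C * √(∑ i ∈ A, f i ^ 2))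
    (M : ℝ) (hM0 : 0 ≤ M) (hM : ∀ i ∈ T, f i ≤ M) :
    ∑ i ∈ T, h i ≤ C * (√m * M + (∑ i ∈ T, f i) / √m) := by
  have hm0 : (0 : ℝ) < m := by exact_mod_cast hm
  have hsm : 0 < √(m : ℝ) := Real.sqrt_pos.2 hm0
  have hsq : √(m : ℝ) * √(m : ℝ) = m := Real.mul_self_sqrt hm0.le
  have hnorm : ∀ A : Finset ι, A.card ≤ m → ∀ N : ℝ, 0 ≤ N → (∀ i ∈ A, f i ≤ N) →
      √(∑ i ∈ A, f i ^ 2) ≤ √m * N := by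
    intro A hA N hN hfN
    refine Real.sqrt_le_iff.2 ⟨by positivity, ?_⟩
    calc ∑ i ∈ A, f i ^ 2 ≤ ∑ i ∈ A, N ^ 2 :=
          Finset.sum_le_sum fun i hi => pow_le_pow_left₀ (hf i) (hfN i hi) 2
      _ = A.card * N ^ 2 := by simp
      _ ≤ m * N ^ 2 := by
          have : (A.card : ℝ) ≤ m := by exact_mod_cast hA
          gcongr
      _ = (√m * N) ^ 2 := by rw [mul_pow, Real.sq_sqrt hm0.le]
  induction hn : T.card using Nat.strong_induction_on generalizing T M with
  | _ n ih =>
  by_cases hTm : T.card ≤ m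
  · have h1 := hblock T subset_rfl hTm
    have h2 := hnorm T hTm M hM0 hM
    have h3 : 0 ≤ (∑ i ∈ T, f i) / √m := div_nonneg (Finset.sum_nonneg fun i _ => hf i) hsm.le
    exact h1.trans (mul_le_mul_of_nonneg_left (by linarith) hC)
  · push Not at hTm
    obtain ⟨A, hAT, hAm, hA⟩ := Finset.exists_subset_card_eq_forall_le f T m hTm.le
    -- Entries left after removing the `m` largest are at most the average `N` of those removed, and
    -- `√m * N` is the `ℓ₁` norm of `A` over `√m`. So the recursion, run with `N` in place of `M`,
    -- charges each block to its predecessor.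
    set N := (∑ i ∈ A, f i) / m with hN
    have hN0 : 0 ≤ N := div_nonneg (Finset.sum_nonneg fun i _ => hf i) hm0.le
    have hNb : ∀ i ∈ T \ A, f i ≤ N := by
      intro b hb
      rw [hN, le_div_iff₀ hm0]
      calc f b * m = ∑ i ∈ A, f b := by simp [hAm, mul_comm]
        _ ≤ ∑ i ∈ A, f i := Finset.sum_le_sum fun a ha => hA a ha b hb
    have hcard : (T \ A).card < n := by
      rw [Finset.card_sdiff_of_subset hAT]; omega
    have h1 := ih _ hcard (T \ A)
      (fun B hB => hblock B (hB.trans Finset.sdiff_subset)) N hN0 hNb rfl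
    have h2 := hblock A hAT hAm.le
    have h3 := hnorm A hAm.le M hM0 fun i hi => hM i (hAT hi)
    have h4 : √m * N = (∑ i ∈ A, f i) / √m := by
      rw [hN, eq_div_iff hsm.ne', mul_right_comm, hsq, mul_div_cancel₀ _ hm0.ne']
    rw [h4, ← add_div] at h1
    rw [← Finset.sum_sdiff hAT, ← Finset.sum_sdiff hAT (f := f)]
    have h5 := mul_le_mul_of_nonneg_left h3 hC
    rw [add_comm (∑ i ∈ A, f i)] at h1
    linarith

/-- Error bound for row norms `d` and a quadratic form `H` that satisfies a sparse lower bound, a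
sparse restricted orthogonality bound, and row-wise optimality inequalities. -/
theorem sqrt_sum_sq_le_of_restricted {ι : Type*} [Fintype ι] [DecidableEq ι]
    (d : ι → ℝ) (hd : ∀ i, 0 ≤ d i) (H : ι → ι → ℝ) (S : Finset ι) (s m : ℕ)
    (hS : S.card = s) (hs : 1 ≤ s) (hm : 1 ≤ m) (hcard : s + m ≤ Fintype.card ι)
    (κ c lam : ℝ) (hκ : 0 < κ) (hc : 0 < c) (hlam : 0 < lam) (hcm : 6 * c ≤ √((m : ℝ) / s))
    (hlow : ∀ A : Finset ι, A.card ≤ s + m →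
      κ * ∑ i ∈ A, d i ^ 2 ≤ ∑ i ∈ A, ∑ j ∈ A, H i j)
    (hcross : ∀ A C : Finset ι, Disjoint A C → A.card ≤ s + m → C.card ≤ s + m →
      -(κ * c * √(∑ i ∈ A, d i ^ 2) * √(∑ i ∈ C, d i ^ 2)) ≤ ∑ i ∈ A, ∑ j ∈ C, H i j)
    (hin : ∀ i ∈ S, ∑ j, H i j ≤ 3 / 2 * lam * d i)
    (hout : ∀ i ∉ S, ∑ j, H i j ≤ -(1 / 2 * lam * d i))
    (hnonneg : 0 ≤ ∑ i, ∑ j, H i j) :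
    √(∑ i, d i ^ 2) ≤ 3 * (1 + (4 * c)⁻¹) / κ * √s * lam := by
  have hm0 : (0 : ℝ) < m := by exact_mod_cast hm
  have hs0 : (0 : ℝ) < s := by exact_mod_cast hs
  have hsm : 0 < √(m : ℝ) := Real.sqrt_pos.2 hm0
  have hss : 0 < √(s : ℝ) := Real.sqrt_pos.2 hs0
  have hsq : √(m : ℝ) * √(m : ℝ) = m := Real.mul_self_sqrt hm0.le
  have hcm' : 6 * c * √s ≤ √m := by
    rw [Real.sqrt_div hm0.le] at hcm
    rwa [le_div_iff₀ hss] at hcm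
  obtain ⟨A0, hA0T, hA0m, hA0⟩ := Finset.exists_subset_card_eq_forall_le d Sᶜ m
    (by rw [Finset.card_compl]; omega)
  have hdisj : Disjoint S A0 :=
    (disjoint_compl_right (a := S)).mono_right hA0T
  set A := S ∪ A0 with hA
  set R := Sᶜ \ A0 with hR
  have hAR : Aᶜ = R := by
    ext i; simp [hA, hR]
  have hAcard : A.card = s + m := by
    rw [hA, Finset.card_union_of_disjoint hdisj, hS, hA0m]
  set x := ∑ i ∈ A0, d i with hx
  set y := ∑ i ∈ R, d i with hy
  have hx0 : 0 ≤ x := Finset.sum_nonneg fun i _ => hd i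
  have hy0 : 0 ≤ y := Finset.sum_nonneg fun i _ => hd i
  have hxy : ∑ i ∈ Sᶜ, d i = x + y := by
    rw [← Finset.sum_sdiff hA0T, add_comm]
  set a := √(∑ i ∈ A, d i ^ 2) with ha
  have ha0 : 0 ≤ a := Real.sqrt_nonneg _
  have hasq : a ^ 2 = ∑ i ∈ A, d i ^ 2 := Real.sq_sqrt (Finset.sum_nonneg fun i _ => sq_nonneg _)
  have hRle : ∀ b ∈ R, d b ≤ x / m := by
    intro b hb
    rw [le_div_iff₀ hm0]
    calc d b * m = ∑ i ∈ A0, d b := by simp [hA0m, mul_comm]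
      _ ≤ ∑ i ∈ A0, d i := Finset.sum_le_sum fun i hi => hA0 i hi b hb
  -- The sum of the row norms over `S`.
  have hSa : ∑ i ∈ S, d i ≤ √s * a := by
    rw [ha, ← Real.sqrt_mul hs0.le]
    refine Real.le_sqrt_of_sq_le ?_
    calc (∑ i ∈ S, d i) ^ 2 ≤ S.card * ∑ i ∈ S, d i ^ 2 := sq_sum_le_card_mul_sum_sq
      _ ≤ s * ∑ i ∈ A, d i ^ 2 := by
        rw [hS]
        refine mul_le_mul_of_nonneg_left ?_ hs0.le
        exact Finset.sum_le_sum_of_subset_of_nonneg Finset.subset_union_left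
          fun i _ _ => sq_nonneg _
  have hrowA0 : ∑ i ∈ A0, ∑ j, H i j ≤ 0 := by
    refine Finset.sum_nonpos fun i hi => ?_
    have := hout i (Finset.mem_compl.1 (hA0T hi))
    have := mul_nonneg hlam.le (hd i)
    linarith
  have hrowS : ∑ i ∈ S, ∑ j, H i j ≤ 3 / 2 * lam * ∑ i ∈ S, d i := by
    rw [Finset.mul_sum]; exact Finset.sum_le_sum hin
  have hrowT : ∑ i ∈ Sᶜ, ∑ j, H i j ≤ -(1 / 2 * lam * (x + y)) := by
    rw [← hxy, Finset.mul_sum, ← Finset.sum_neg_distrib]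
    exact Finset.sum_le_sum fun i hi => hout i (Finset.mem_compl.1 hi)
  -- The cone constant 3 is the ratio of the row bounds `3/2` and `1/2`.
  have hcone : x + y ≤ 3 * (√s * a) := by
    rw [← Finset.sum_add_sum_compl S] at hnonneg
    have : lam * (x + y) ≤ lam * (3 * ∑ i ∈ S, d i) := by linarith
    have := le_of_mul_le_mul_left this hlam
    linarith
  have hratio : (x + y) / √m ≤ a / (2 * c) := by
    rw [div_le_div_iff₀ hsm (by positivity)]
    calc (x + y) * (2 * c) ≤ 3 * (√s * a) * (2 * c) := by gcongr
      _ = a * (6 * c * √s) := by ring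
      _ ≤ a * √m := by gcongr
  -- With the average `x / m` over `A0` as initial bound, the first block of `R` is charged to `A0`,
  -- so all of `x + y` appears over `√m`.
  have hoff : ∑ l ∈ R, -(∑ i ∈ A, H i l) ≤ κ * c * a * (√m * (x / m) + y / √m) := by
    refine sum_le_of_forall_block_le d _ hd m hm (κ * c * a) (by positivity) R ?_ (x / m)
      (by positivity) hRle
    intro C hC hCm
    have hAC : Disjoint A C := by
      rw [← hAR] at hC
      exact (disjoint_compl_right (a := A)).mono_right hC
    have := hcross A C hAC hAcard.le (by omega)
    rw [Finset.sum_comm] at this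
    rw [Finset.sum_neg_distrib]
    linarith
  have hoff' : ∑ l ∈ R, -(∑ i ∈ A, H i l) ≤ κ * a ^ 2 / 2 := by
    have h1 : √m * (x / m) + y / √m = (x + y) / √m := by
      nth_rewrite 2 [← hsq]; field_simp
    rw [h1] at hoff
    refine hoff.trans ?_
    calc κ * c * a * ((x + y) / √m) ≤ κ * c * a * (a / (2 * c)) := by gcongr
      _ = κ * a ^ 2 / 2 := by field_simp
  -- `H(A, A)` is the full row sums over `A` minus `H(A, R)`. The rows of `A0` contribute
  -- nonpositively and are dropped, so `√s` appears rather than `√(s + m)`.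
  have hquad : κ * a ^ 2 ≤ 3 / 2 * lam * (√s * a) + κ * a ^ 2 / 2 := by
    have h1 := hlow A hAcard.le
    rw [← hasq] at h1
    have h2 : ∑ i ∈ A, ∑ j ∈ A, H i j
        = ∑ i ∈ A, ∑ j, H i j + ∑ l ∈ R, -(∑ i ∈ A, H i l) := by
      rw [Finset.sum_neg_distrib, Finset.sum_comm (s := R), ← sub_eq_add_neg,
        ← Finset.sum_sub_distrib]
      refine Finset.sum_congr rfl fun i _ => ?_
      rw [← Finset.sum_add_sum_compl A, hAR]; ring
    have h3 : ∑ i ∈ A, ∑ j, H i j = ∑ i ∈ S, ∑ j, H i j + ∑ i ∈ A0, ∑ j, H i j :=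
      Finset.sum_union hdisj
    have h4 := mul_le_mul_of_nonneg_left hSa (by positivity : (0 : ℝ) ≤ 3 / 2 * lam)
    linarith
  have hale : a ≤ 3 * (√s * lam) / κ := by
    rw [le_div_iff₀ hκ]
    rcases ha0.eq_or_lt with h | h
    · rw [← h]; simp; positivity
    · have : a * (a * κ) ≤ a * (3 * (√s * lam)) := by linarith
      exact le_of_mul_le_mul_left this h
  -- Bounding one factor by `x / m` leaves `x * y / m`. The half from AM-GM turns the `2 * c` of
  -- `hratio` into `4 * c`.
  have htail : ∑ i ∈ R, d i ^ 2 ≤ (a * (4 * c)⁻¹) ^ 2 := by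
    calc ∑ i ∈ R, d i ^ 2 ≤ ∑ i ∈ R, x / m * d i := Finset.sum_le_sum fun i hi => by
          rw [sq]; exact mul_le_mul_of_nonneg_right (hRle i hi) (hd i)
      _ = x * y / m := by rw [← Finset.mul_sum]; ring
      _ ≤ ((x + y) / 2) ^ 2 / m := by
          gcongr; nlinarith [sq_nonneg (x - y)]
      _ = ((x + y) / √m / 2) ^ 2 := by
          nth_rewrite 1 [← hsq]; field_simp
      _ ≤ (a / (2 * c) / 2) ^ 2 := by gcongr
      _ = (a * (4 * c)⁻¹) ^ 2 := by field_simp; norm_num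
  have htot : ∑ i, d i ^ 2 ≤ (a * (1 + (4 * c)⁻¹)) ^ 2 := by
    rw [← Finset.sum_add_sum_compl A, hAR, ← hasq]
    have : 0 ≤ a * (a * (4 * c)⁻¹) := by positivity
    nlinarith
  calc √(∑ i, d i ^ 2) ≤ a * (1 + (4 * c)⁻¹) := Real.sqrt_le_iff.2 ⟨by positivity, htot⟩
    _ ≤ 3 * (√s * lam) / κ * (1 + (4 * c)⁻¹) := by gcongr
    _ = 3 * (1 + (4 * c)⁻¹) / κ * √s * lam := by ring

/-! ### Extremal singular values and quadratic forms -/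

open scoped InnerProductSpace in
-- The squared norm is the quadratic form of `T†T`, diagonal in its eigenbasis. Its eigenvalues are
-- the squared singular values, so bounding them by the extreme ones bounds `‖T x‖`.
theorem LinearMap.norm_apply_sq_eq_sum_eigenvalues {E : Type*} [NormedAddCommGroup E]
    [InnerProductSpace ℝ E] [FiniteDimensional ℝ E] (T : E →ₗ[ℝ] E) (x : E) :
    ‖T x‖ ^ 2 = ∑ i, T.isSymmetric_adjoint_comp_self.eigenvalues rfl i *
      ⟪T.isSymmetric_adjoint_comp_self.eigenvectorBasis rfl i, x⟫_ℝ ^ 2 := by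
  have hT := T.isSymmetric_adjoint_comp_self
  set b := hT.eigenvectorBasis rfl with hb
  rw [← real_inner_self_eq_norm_sq, ← LinearMap.adjoint_inner_left, ← b.sum_inner_mul_inner]
  refine Finset.sum_congr rfl fun i _ => ?_
  have := hT (b i) x
  simp only [LinearMap.comp_apply] at this
  have h2 := hT.apply_eigenvectorBasis rfl i
  simp only [LinearMap.comp_apply] at h2
  rw [real_inner_comm, ← this, hb, h2, inner_smul_left, ← hb]
  simp [sq, real_inner_comm]
  ring

open scoped InnerProductSpace in
theorem LinearMap.norm_apply_le_singularValues_zero {E : Type*} [NormedAddCommGroup E]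
    [InnerProductSpace ℝ E] [FiniteDimensional ℝ E] (T : E →ₗ[ℝ] E) (x : E) :
    ‖T x‖ ≤ T.singularValues 0 * ‖x‖ := by
  refine abs_le_of_sq_le_sq' ?_ (mul_nonneg (T.singularValues_nonneg 0) (norm_nonneg x)) |>.2
  rw [T.norm_apply_sq_eq_sum_eigenvalues, mul_pow,
    ← (T.isSymmetric_adjoint_comp_self.eigenvectorBasis rfl).sum_sq_inner_right x, Finset.mul_sum]
  refine Finset.sum_le_sum fun i _ => mul_le_mul_of_nonneg_right ?_ (sq_nonneg _)
  rw [← T.sq_singularValues_fin rfl i]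
  exact pow_le_pow_left₀ (T.singularValues_nonneg _) (T.singularValues_antitone (Nat.zero_le _)) 2

open scoped InnerProductSpace in
theorem LinearMap.singularValues_last_le_norm_apply {E : Type*} [NormedAddCommGroup E]
    [InnerProductSpace ℝ E] [FiniteDimensional ℝ E] (T : E →ₗ[ℝ] E) (x : E) :
    T.singularValues (Module.finrank ℝ E - 1) * ‖x‖ ≤ ‖T x‖ := by
  refine abs_le_of_sq_le_sq' ?_ (norm_nonneg _) |>.2
  rw [T.norm_apply_sq_eq_sum_eigenvalues, mul_pow,
    ← (T.isSymmetric_adjoint_comp_self.eigenvectorBasis rfl).sum_sq_inner_right x, Finset.mul_sum]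
  refine Finset.sum_le_sum fun i _ => mul_le_mul_of_nonneg_right ?_ (sq_nonneg _)
  rw [← T.sq_singularValues_fin rfl i]
  exact pow_le_pow_left₀ (T.singularValues_nonneg _)
    (T.singularValues_antitone (by have := i.2; omega)) 2

open scoped InnerProductSpace in
-- An eigenvalue of a positive operator is the norm of `T` at a unit eigenvector, hence at least the
-- last singular value. No matching of eigenvalues with singular values is needed.
theorem LinearMap.IsPositive.singularValues_last_mul_le_inner {E : Type*} [NormedAddCommGroup E]
    [InnerProductSpace ℝ E] [FiniteDimensional ℝ E] {T : E →ₗ[ℝ] E} (hT : T.IsPositive) (x : E) :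
    T.singularValues (Module.finrank ℝ E - 1) * ‖x‖ ^ 2 ≤ ⟪T x, x⟫_ℝ := by
  have hS := hT.isSymmetric
  set b := hS.eigenvectorBasis rfl with hb
  have h1 : ⟪T x, x⟫_ℝ = ∑ i, hS.eigenvalues rfl i * ⟪b i, x⟫_ℝ ^ 2 := by
    rw [← b.sum_inner_mul_inner]
    refine Finset.sum_congr rfl fun i _ => ?_
    rw [hS x (b i), hb, hS.apply_eigenvectorBasis rfl i, inner_smul_right, ← hb]
    simp [sq, real_inner_comm]
    ring
  rw [h1, ← b.sum_sq_inner_right x, Finset.mul_sum]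
  refine Finset.sum_le_sum fun i _ => mul_le_mul_of_nonneg_right ?_ (sq_nonneg _)
  have h2 := T.singularValues_last_le_norm_apply (b i)
  rw [hb, hS.apply_eigenvectorBasis rfl i, ← hb, norm_smul, b.norm_eq_one] at h2
  simpa [abs_of_nonneg (hT.nonneg_eigenvalues rfl i)] using h2

/-! ### Euclidean norms and sparse Riesz constants -/

theorem vecNorm_sq {ι : Type*} [Fintype ι] (v : ι → ℝ) : vecNorm v ^ 2 = v ⬝ᵥ v := by
  rw [vecNorm, EuclideanSpace.norm_sq_eq]
  simp [dotProduct, sq]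

theorem vecNorm_nonneg {ι : Type*} [Fintype ι] (v : ι → ℝ) : 0 ≤ vecNorm v := norm_nonneg _

theorem dotProduct_le_vecNorm_mul {ι : Type*} [Fintype ι] (v w : ι → ℝ) :
    v ⬝ᵥ w ≤ vecNorm v * vecNorm w := by
  have := real_inner_le_norm (WithLp.toLp 2 v : EuclideanSpace ℝ ι) (WithLp.toLp 2 w)
  simpa [vecNorm, PiLp.inner_apply, dotProduct, mul_comm] using this

theorem vecNorm_add_le {ι : Type*} [Fintype ι] (v w : ι → ℝ) :
    vecNorm (v + w) ≤ vecNorm v + vecNorm w := norm_add_le (WithLp.toLp 2 v) (WithLp.toLp 2 w)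

theorem vecNorm_smul {ι : Type*} [Fintype ι] (t : ℝ) (v : ι → ℝ) :
    vecNorm (t • v) = |t| * vecNorm v := norm_smul t (WithLp.toLp 2 v : EuclideanSpace ℝ ι)

theorem sigmaMax_nonneg {ι : Type*} [Fintype ι] [DecidableEq ι] (G : Matrix ι ι ℝ) :
    0 ≤ sigmaMax G := LinearMap.singularValues_nonneg _ _

theorem sigmaMin_nonneg {ι : Type*} [Fintype ι] [DecidableEq ι] (G : Matrix ι ι ℝ) :
    0 ≤ sigmaMin G := LinearMap.singularValues_nonneg _ _

theorem inner_toEuclideanLin {ι : Type*} [Fintype ι] [DecidableEq ι] (G : Matrix ι ι ℝ)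
    (u : ι → ℝ) : inner ℝ (Matrix.toEuclideanLin G (WithLp.toLp 2 u)) (WithLp.toLp 2 u)
      = u ⬝ᵥ G.mulVec u := by
  simp [PiLp.inner_apply, Matrix.toLpLin_apply, dotProduct]

theorem sigmaMin_mul_le {ι : Type*} [Fintype ι] [DecidableEq ι] (G : Matrix ι ι ℝ)
    (hG : G.PosSemidef) (u : ι → ℝ) : sigmaMin G * (u ⬝ᵥ u) ≤ u ⬝ᵥ G.mulVec u := by
  have h := (Matrix.isPositive_toEuclideanLin_iff.2 hG).singularValues_last_mul_le_inner
    (WithLp.toLp 2 u)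
  rw [inner_toEuclideanLin, finrank_euclideanSpace] at h
  rwa [← vecNorm_sq]

theorem le_sigmaMax_mul {ι : Type*} [Fintype ι] [DecidableEq ι] (G : Matrix ι ι ℝ)
    (u : ι → ℝ) : u ⬝ᵥ G.mulVec u ≤ sigmaMax G * (u ⬝ᵥ u) := by
  rw [← inner_toEuclideanLin, ← vecNorm_sq, sq, ← mul_assoc]
  refine (real_inner_le_norm _ _).trans ?_
  exact mul_le_mul_of_nonneg_right (LinearMap.norm_apply_le_singularValues_zero _ _)
    (norm_nonneg _)

theorem gramOn_posSemidef {n p : ℕ} (X : Matrix (Fin n) (Fin p) ℝ) (T : Finset (Fin p)) :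
    (gramOn X T).PosSemidef := by
  simpa [gramOn] using Matrix.posSemidef_conjTranspose_mul_self (colSubmatrix X T)

theorem dotProduct_gramOn {n p : ℕ} (X : Matrix (Fin n) (Fin p) ℝ) (T : Finset (Fin p))
    (u : Fin p → ℝ) (hu : ∀ j ∉ T, u j = 0) :
    (fun j : T => u j) ⬝ᵥ (gramOn X T).mulVec (fun j : T => u j)
      = X.mulVec u ⬝ᵥ X.mulVec u := by
  have h : (colSubmatrix X T).mulVec (fun j : T => u j) = X.mulVec u := by
    ext i
    simp only [Matrix.mulVec, dotProduct, colSubmatrix, Matrix.submatrix_apply, id]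
    rw [Finset.sum_coe_sort T (fun j => X i j * u j)]
    exact Finset.sum_subset (Finset.subset_univ T) fun j _ hj => by simp [hu j hj]
  rw [gramOn, ← Matrix.mulVec_mulVec, Matrix.dotProduct_mulVec, Matrix.vecMul_transpose, h]

theorem dotProduct_self_restrict {p : ℕ} (T : Finset (Fin p))
    (u : Fin p → ℝ) (hu : ∀ j ∉ T, u j = 0) :
    (fun j : T => u j) ⬝ᵥ (fun j : T => u j) = u ⬝ᵥ u := by
  simp only [dotProduct]
  rw [Finset.sum_coe_sort T (fun j => u j * u j)]
  exact Finset.sum_subset (Finset.subset_univ T) fun j _ hj => by simp [hu j hj]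

/-- The minimum runs over exactly `k` columns, so a smaller support is first padded to size `k`,
which is possible as `k ≤ p`. -/
theorem kappaMinus_sq_mul_le {n p : ℕ} (X : Matrix (Fin n) (Fin p) ℝ) (k : ℕ) (hk : k ≤ p)
    (T : Finset (Fin p)) (hT : T.card ≤ k) (u : Fin p → ℝ) (hu : ∀ j ∉ T, u j = 0) :
    kappaMinus X k ^ 2 * (u ⬝ᵥ u) ≤ X.mulVec u ⬝ᵥ X.mulVec u := by
  obtain ⟨T', hTT', -, hT'⟩ := Finset.exists_subsuperset_card_eq (Finset.subset_univ T) hT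
    (by simpa using hk)
  have hu' : ∀ j ∉ T', u j = 0 := fun j hj => hu j fun h => hj (hTT' h)
  have h1 := sigmaMin_mul_le _ (gramOn_posSemidef X T') (fun j : T' => u j)
  rw [dotProduct_gramOn X T' u hu', dotProduct_self_restrict T' u hu'] at h1
  refine le_trans (mul_le_mul_of_nonneg_right ?_ (by rw [← vecNorm_sq]; positivity)) h1
  rw [kappaMinus, Real.sq_sqrt (Real.iInf_nonneg fun T => sigmaMin_nonneg _)]
  exact ciInf_le (Set.finite_range
    (fun T : {T : Finset (Fin p) // T.card = k} => sigmaMin (gramOn X T.1))).bddBelow ⟨T', hT'⟩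

theorem le_kappaPlus_sq_mul {n p : ℕ} (X : Matrix (Fin n) (Fin p) ℝ) (k : ℕ) (hk : k ≤ p)
    (T : Finset (Fin p)) (hT : T.card ≤ k) (u : Fin p → ℝ) (hu : ∀ j ∉ T, u j = 0) :
    X.mulVec u ⬝ᵥ X.mulVec u ≤ kappaPlus X k ^ 2 * (u ⬝ᵥ u) := by
  obtain ⟨T', hTT', -, hT'⟩ := Finset.exists_subsuperset_card_eq (Finset.subset_univ T) hT
    (by simpa using hk)
  have hu' : ∀ j ∉ T', u j = 0 := fun j hj => hu j fun h => hj (hTT' h)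
  have h1 := le_sigmaMax_mul (gramOn X T') (fun j : T' => u j)
  rw [dotProduct_gramOn X T' u hu', dotProduct_self_restrict T' u hu'] at h1
  refine h1.trans (mul_le_mul_of_nonneg_right ?_ (by rw [← vecNorm_sq]; positivity))
  rw [kappaPlus, Real.sq_sqrt (Real.iSup_nonneg fun T => sigmaMax_nonneg _)]
  exact le_ciSup (Set.finite_range
    (fun T : {T : Finset (Fin p) // T.card = k} => sigmaMax (gramOn X T.1))).bddAbove ⟨T', hT'⟩

/-! ### Frobenius norm and row-wise optimality -/

theorem Matrix.frobenius_norm_sq {m n : ℕ} (A : Matrix (Fin m) (Fin n) ℝ) :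
    ‖A‖ ^ 2 = ∑ i, ∑ k, A i k ^ 2 := by
  rw [Matrix.frobenius_norm_def, ← Real.sqrt_eq_rpow,
    Real.sq_sqrt (Finset.sum_nonneg fun i _ => Finset.sum_nonneg fun j _ => by positivity)]
  simp

theorem Matrix.frobenius_norm_eq_sqrt_sum_vecNorm_sq {m n : ℕ} (A : Matrix (Fin m) (Fin n) ℝ) :
    ‖A‖ = √(∑ i, vecNorm (A.row i) ^ 2) := by
  rw [← Real.sqrt_sq (norm_nonneg A), Matrix.frobenius_norm_sq]
  simp_rw [vecNorm_sq]
  simp [dotProduct, sq]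

theorem norm21_add_vecMulVec_single {p r : ℕ} (B : Matrix (Fin p) (Fin r) ℝ) (j : Fin p)
    (v : Fin r → ℝ) :
    norm21 (B + Matrix.vecMulVec (Pi.single j 1) v)
      = norm21 B + (vecNorm (B.row j + v) - vecNorm (B.row j)) := by
  rw [norm21, norm21, ← Finset.add_sum_erase _ _ (Finset.mem_univ j),
    ← Finset.add_sum_erase (a := j) (f := fun j => vecNorm (B.row j)) _ (Finset.mem_univ j)]
  have h1 : (B + Matrix.vecMulVec (Pi.single j 1) v).row j = B.row j + v := by
    ext k; simp [Matrix.vecMulVec_apply]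
  have h2 : ∀ i ∈ Finset.univ.erase j,
      vecNorm ((B + Matrix.vecMulVec (Pi.single j 1) v).row i) = vecNorm (B.row i) := by
    intro i hi
    congr 1
    ext k; simp [Matrix.vecMulVec_apply, Finset.ne_of_mem_erase hi]
  rw [h1, Finset.sum_congr rfl h2]
  ring

theorem norm_sub_mul_add_vecMulVec_single_sq {n p r : ℕ} (X : Matrix (Fin n) (Fin p) ℝ)
    (W : Matrix (Fin n) (Fin r) ℝ) (B : Matrix (Fin p) (Fin r) ℝ) (j : Fin p) (v : Fin r → ℝ) :
    ‖W - X * (B + Matrix.vecMulVec (Pi.single j 1) v)‖ ^ 2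
      = ‖W - X * B‖ ^ 2 - 2 * (Matrix.vecMul (X.col j) (W - X * B) ⬝ᵥ v)
        + (X.col j ⬝ᵥ X.col j) * (v ⬝ᵥ v) := by
  have h1 : W - X * (B + Matrix.vecMulVec (Pi.single j 1) v)
      = (W - X * B) - Matrix.vecMulVec (X.col j) v := by
    rw [Matrix.mul_add, Matrix.mul_vecMulVec, sub_add_eq_sub_sub, Matrix.mulVec_single_one]
  rw [h1, Matrix.frobenius_norm_sq, Matrix.frobenius_norm_sq]
  set P := W - X * B
  have h2 : Matrix.vecMul (X.col j) P ⬝ᵥ v = ∑ i, ∑ k, P i k * (X.col j i * v k) := by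
    simp only [Matrix.vecMul, dotProduct, Finset.sum_mul]
    rw [Finset.sum_comm]
    exact Finset.sum_congr rfl fun _ _ => Finset.sum_congr rfl fun _ _ => by ring
  have h3 : (X.col j ⬝ᵥ X.col j) * (v ⬝ᵥ v) = ∑ i, ∑ k, (X.col j i * v k) ^ 2 := by
    simp only [dotProduct, Finset.sum_mul_sum]
    exact Finset.sum_congr rfl fun _ _ => Finset.sum_congr rfl fun _ _ => by ring
  rw [h2, h3, Finset.mul_sum, ← Finset.sum_sub_distrib, ← Finset.sum_add_distrib]
  refine Finset.sum_congr rfl fun i _ => ?_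
  rw [Finset.mul_sum, ← Finset.sum_sub_distrib, ← Finset.sum_add_distrib]
  refine Finset.sum_congr rfl fun k _ => ?_
  rw [Matrix.sub_apply, Matrix.vecMulVec_apply]
  ring

/-- The optimality condition of the group Lasso for one row, as a variational inequality. -/
theorem IsGroupLasso.dotProduct_le {n p r : ℕ} {X : Matrix (Fin n) (Fin p) ℝ}
    {W : Matrix (Fin n) (Fin r) ℝ} {lam : ℝ} (hlam : 0 < lam) {Bhat : Matrix (Fin p) (Fin r) ℝ}
    (h : IsGroupLasso X W lam Bhat) (j : Fin p) (v : Fin r → ℝ) :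
    Matrix.vecMul (X.col j) (W - X * Bhat) ⬝ᵥ v
      ≤ lam * (vecNorm (Bhat.row j + v) - vecNorm (Bhat.row j)) := by
  set g := Matrix.vecMul (X.col j) (W - X * Bhat) ⬝ᵥ v with hg
  set D := lam * (vecNorm (Bhat.row j + v) - vecNorm (Bhat.row j)) with hD
  set q := (X.col j ⬝ᵥ X.col j) * (v ⬝ᵥ v) with hq
  have hq0 : 0 ≤ q := by
    rw [hq, ← vecNorm_sq, ← vecNorm_sq]; positivity
  -- Compare `Bhat` with its perturbation by `t • v` in row `j`. Convexity bounds the penalty change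
  -- by `t * D`, so no subgradient of the norm at zero is needed; then divide by `t`.
  have key : ∀ t : ℝ, 0 < t → t ≤ 1 → g ≤ t * q + D := by
    intro t ht0 ht1
    have h1 := h (Bhat + Matrix.vecMulVec (Pi.single j 1) (t • v))
    rw [groupLassoObjective, groupLassoObjective, norm_sub_mul_add_vecMulVec_single_sq,
      norm21_add_vecMulVec_single] at h1
    have h2 : vecNorm (Bhat.row j + t • v)
        ≤ (1 - t) * vecNorm (Bhat.row j) + t * vecNorm (Bhat.row j + v) := by
      have : Bhat.row j + t • v = (1 - t) • Bhat.row j + t • (Bhat.row j + v) := by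
        rw [smul_add, sub_smul, one_smul]; abel
      rw [this]
      refine (vecNorm_add_le _ _).trans ?_
      rw [vecNorm_smul, vecNorm_smul, abs_of_nonneg ht0.le, abs_of_nonneg (by linarith)]
    have h3 : lam * (vecNorm (Bhat.row j + t • v) - vecNorm (Bhat.row j)) ≤ t * D := by
      have := mul_le_mul_of_nonneg_left h2 hlam.le
      rw [hD]; linarith
    simp only [dotProduct_smul, smul_dotProduct, smul_eq_mul] at h1
    rw [← hg] at h1
    have h4 : X.col j ⬝ᵥ X.col j * (t * (t * v ⬝ᵥ v)) = t * (t * q) := by rw [hq]; ring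
    rw [h4] at h1
    have h5 : t * g ≤ t * (t * q + D) := by
      have := mul_nonneg ht0.le (mul_nonneg ht0.le hq0)
      linarith
    exact le_of_mul_le_mul_left h5 ht0
  by_contra hlt
  push Not at hlt
  -- An explicit small `t` replaces the limit `t → 0`: it makes `t * q ≤ (g - D) / 2`, which
  -- contradicts `D < g`.
  have hpos : 0 < (g - D) / (2 * (q + 1)) := by apply div_pos <;> linarith
  have h1 := key (min 1 ((g - D) / (2 * (q + 1)))) (lt_min one_pos hpos) (min_le_left _ _)
  have h2 : min 1 ((g - D) / (2 * (q + 1))) * q ≤ (g - D) / (2 * (q + 1)) * (q + 1) :=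
    mul_le_mul (min_le_right _ _) (by linarith) hq0 hpos.le
  have h3 : (g - D) / (2 * (q + 1)) * (q + 1) = (g - D) / 2 := by field_simp
  linarith

/-! ### Weighted Gram form and restricted orthogonality -/

/-- The Gram matrix of `X` weighted by the inner products of the rows of `D`. -/
def rowGram {n p r : ℕ} (X : Matrix (Fin n) (Fin p) ℝ) (D : Matrix (Fin p) (Fin r) ℝ)
    (i j : Fin p) : ℝ :=
  (X.transpose * X) i j * (D.row i ⬝ᵥ D.row j)

theorem sum_rowGram {n p r : ℕ} (X : Matrix (Fin n) (Fin p) ℝ) (D : Matrix (Fin p) (Fin r) ℝ)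
    (j : Fin p) : ∑ l, rowGram X D j l = Matrix.vecMul (X.col j) (X * D) ⬝ᵥ D.row j := by
  have h : Matrix.vecMul (X.col j) (X * D) = (X.transpose * X * D).row j := by
    rw [Matrix.mul_assoc]
    ext k
    simp [Matrix.vecMul, Matrix.mul_apply, dotProduct]
  rw [h]
  simp only [rowGram, dotProduct, Matrix.row, Matrix.mul_apply (M := X.transpose * X),
    Finset.sum_mul, Finset.mul_sum]
  rw [Finset.sum_comm]
  exact Finset.sum_congr rfl fun _ _ => Finset.sum_congr rfl fun _ _ => by ring

/-- The form splits over the columns of `D`, so sparse eigenvalue bounds for vectors pass to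
matrices. The weights select rows and allow different scalings on two blocks. -/
theorem sum_mul_rowGram {n p r : ℕ} (X : Matrix (Fin n) (Fin p) ℝ)
    (D : Matrix (Fin p) (Fin r) ℝ) (w : Fin p → ℝ) :
    ∑ i, ∑ j, w i * w j * rowGram X D i j
      = ∑ k, X.mulVec (fun j => w j * D j k) ⬝ᵥ X.mulVec (fun j => w j * D j k) := by
  have h : ∀ u : Fin p → ℝ, X.mulVec u ⬝ᵥ X.mulVec u
      = ∑ i, ∑ j, u i * u j * (X.transpose * X) i j := by
    intro u
    rw [← Matrix.vecMul_transpose X u, ← Matrix.dotProduct_mulVec, Matrix.vecMul_transpose,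
      Matrix.mulVec_mulVec]
    simp only [dotProduct, Matrix.mulVec, Finset.mul_sum]
    exact Finset.sum_congr rfl fun _ _ => Finset.sum_congr rfl fun _ _ => by ring
  simp_rw [h]
  rw [Finset.sum_comm (s := (Finset.univ : Finset (Fin r)))]
  refine Finset.sum_congr rfl fun i _ => ?_
  rw [Finset.sum_comm (s := (Finset.univ : Finset (Fin r)))]
  refine Finset.sum_congr rfl fun j _ => ?_
  simp only [rowGram, dotProduct, Matrix.row, Finset.mul_sum]
  exact Finset.sum_congr rfl fun _ _ => by ring

theorem sum_mul_vecNorm_row_sq {p r : ℕ} (D : Matrix (Fin p) (Fin r) ℝ) (w : Fin p → ℝ) :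
    ∑ i, w i ^ 2 * vecNorm (D.row i) ^ 2
      = ∑ k, (fun j => w j * D j k) ⬝ᵥ (fun j => w j * D j k) := by
  simp only [vecNorm_sq, dotProduct, Matrix.row, Finset.mul_sum]
  rw [Finset.sum_comm]
  exact Finset.sum_congr rfl fun _ _ => Finset.sum_congr rfl fun _ _ => by ring

theorem sum_rowGram_nonneg {n p r : ℕ} (X : Matrix (Fin n) (Fin p) ℝ)
    (D : Matrix (Fin p) (Fin r) ℝ) : 0 ≤ ∑ i, ∑ j, rowGram X D i j := by
  have := sum_mul_rowGram X D (fun _ => 1)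
  simp only [one_mul] at this
  rw [this]
  exact Finset.sum_nonneg fun k _ => by rw [← vecNorm_sq]; positivity

theorem kappaMinus_sq_mul_sum_le {n p r : ℕ} (X : Matrix (Fin n) (Fin p) ℝ)
    (D : Matrix (Fin p) (Fin r) ℝ) (k : ℕ) (hk : k ≤ p) (T : Finset (Fin p)) (hT : T.card ≤ k)
    (w : Fin p → ℝ) (hw : ∀ j ∉ T, w j = 0) :
    kappaMinus X k ^ 2 * ∑ i, w i ^ 2 * vecNorm (D.row i) ^ 2
      ≤ ∑ i, ∑ j, w i * w j * rowGram X D i j := by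
  rw [sum_mul_rowGram, sum_mul_vecNorm_row_sq, Finset.mul_sum]
  exact Finset.sum_le_sum fun l _ =>
    kappaMinus_sq_mul_le X k hk T hT _ fun j hj => by simp [hw j hj]

theorem sum_le_kappaPlus_sq_mul {n p r : ℕ} (X : Matrix (Fin n) (Fin p) ℝ)
    (D : Matrix (Fin p) (Fin r) ℝ) (k : ℕ) (hk : k ≤ p) (T : Finset (Fin p)) (hT : T.card ≤ k)
    (w : Fin p → ℝ) (hw : ∀ j ∉ T, w j = 0) :
    ∑ i, ∑ j, w i * w j * rowGram X D i j
      ≤ kappaPlus X k ^ 2 * ∑ i, w i ^ 2 * vecNorm (D.row i) ^ 2 := by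
  rw [sum_mul_rowGram, sum_mul_vecNorm_row_sq, Finset.mul_sum]
  exact Finset.sum_le_sum fun l _ =>
    le_kappaPlus_sq_mul X k hk T hT _ fun j hj => by simp [hw j hj]

theorem sum_ite_mem_eq {p : ℕ} (A : Finset (Fin p)) (f : Fin p → ℝ) :
    ∑ i, (if i ∈ A then f i else 0) = ∑ i ∈ A, f i := by
  rw [Finset.sum_ite_mem, Finset.univ_inter]

theorem rowGram_comm {n p r : ℕ} (X : Matrix (Fin n) (Fin p) ℝ)
    (D : Matrix (Fin p) (Fin r) ℝ) (i j : Fin p) : rowGram X D i j = rowGram X D j i := by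
  rw [rowGram, rowGram, dotProduct_comm]
  simp [Matrix.mul_apply, mul_comm]

theorem sum_sum_indicator {p : ℕ} (H : Fin p → Fin p → ℝ) (A C : Finset (Fin p)) (a c : ℝ) :
    ∑ i, ∑ j, (if i ∈ A then a else 0) * (if j ∈ C then c else 0) * H i j
      = a * c * ∑ i ∈ A, ∑ j ∈ C, H i j := by
  rw [← sum_ite_mem_eq A, Finset.mul_sum]
  refine Finset.sum_congr rfl fun i _ => ?_
  split_ifs
  · rw [← sum_ite_mem_eq C, Finset.mul_sum]
    exact Finset.sum_congr rfl fun j _ => by split_ifs <;> simp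
  · simp

theorem kappaMinus_sq_mul_sum_finset_le {n p r : ℕ} (X : Matrix (Fin n) (Fin p) ℝ)
    (D : Matrix (Fin p) (Fin r) ℝ) (k : ℕ) (hk : k ≤ p) (A : Finset (Fin p)) (hA : A.card ≤ k) :
    kappaMinus X k ^ 2 * ∑ i ∈ A, vecNorm (D.row i) ^ 2
      ≤ ∑ i ∈ A, ∑ j ∈ A, rowGram X D i j := by
  have h := kappaMinus_sq_mul_sum_le X D k hk A hA (fun i => if i ∈ A then 1 else 0)
    (fun j hj => by simp [hj])
  rw [sum_sum_indicator] at h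
  simpa using h

/-- Restricted orthogonality: for disjoint supports of size at most `k` the cross term is at least
`-(κ₊(k)² - κ₋(2k)²)` times the product of the norms. -/
theorem neg_le_sum_sum_rowGram {n p r : ℕ} (X : Matrix (Fin n) (Fin p) ℝ)
    (D : Matrix (Fin p) (Fin r) ℝ) (k : ℕ) (hk : 2 * k ≤ p) (A C : Finset (Fin p))
    (hAC : Disjoint A C) (hA : A.card ≤ k) (hC : C.card ≤ k) :
    -((kappaPlus X k ^ 2 - kappaMinus X (2 * k) ^ 2) * √(∑ i ∈ A, vecNorm (D.row i) ^ 2)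
        * √(∑ i ∈ C, vecNorm (D.row i) ^ 2)) ≤ ∑ i ∈ A, ∑ j ∈ C, rowGram X D i j := by
  set a := √(∑ i ∈ A, vecNorm (D.row i) ^ 2) with ha
  set c := √(∑ i ∈ C, vecNorm (D.row i) ^ 2) with hc
  have hasq : a ^ 2 = ∑ i ∈ A, vecNorm (D.row i) ^ 2 :=
    Real.sq_sqrt (Finset.sum_nonneg fun i _ => sq_nonneg _)
  have hcsq : c ^ 2 = ∑ i ∈ C, vecNorm (D.row i) ^ 2 :=
    Real.sq_sqrt (Finset.sum_nonneg fun i _ => sq_nonneg _)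
  set I := ∑ i ∈ A, ∑ j ∈ C, rowGram X D i j with hI
  have hsum : ∀ α β : ℝ, ∑ i, ((if i ∈ A then α else 0) + (if i ∈ C then β else 0)) ^ 2
      * vecNorm (D.row i) ^ 2 = α ^ 2 * a ^ 2 + β ^ 2 * c ^ 2 := by
    intro α β
    rw [hasq, hcsq, ← sum_ite_mem_eq A, ← sum_ite_mem_eq C, Finset.mul_sum, Finset.mul_sum,
      ← Finset.sum_add_distrib]
    refine Finset.sum_congr rfl fun i _ => ?_
    by_cases h1 : i ∈ A
    · simp [h1, Finset.disjoint_left.1 hAC h1]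
    · simp [h1]
  have hquad : ∀ α β : ℝ, ∑ i, ∑ j, ((if i ∈ A then α else 0) + (if i ∈ C then β else 0))
      * ((if j ∈ A then α else 0) + (if j ∈ C then β else 0)) * rowGram X D i j
      = α ^ 2 * (∑ i ∈ A, ∑ j ∈ A, rowGram X D i j)
        + β ^ 2 * (∑ i ∈ C, ∑ j ∈ C, rowGram X D i j) + 2 * (α * β * I) := by
    intro α β
    have hsymm : ∑ i ∈ C, ∑ j ∈ A, rowGram X D i j = I := by
      rw [Finset.sum_comm, hI]
      exact Finset.sum_congr rfl fun _ _ => Finset.sum_congr rfl fun _ _ => rowGram_comm _ _ _ _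
    simp only [add_mul, mul_add, Finset.sum_add_distrib, sum_sum_indicator]
    rw [hsymm]
    ring
  have hplus : ∀ T : Finset (Fin p), T.card ≤ k →
      ∑ i ∈ T, ∑ j ∈ T, rowGram X D i j
        ≤ kappaPlus X k ^ 2 * ∑ i ∈ T, vecNorm (D.row i) ^ 2 := by
    intro T hT
    have h := sum_le_kappaPlus_sq_mul X D k (by omega) T hT (fun i => if i ∈ T then 1 else 0)
      (fun j hj => by simp [hj])
    rw [sum_sum_indicator] at h
    simpa using h
  -- Polarization: bound the form below by `κ₋(2k)²` on the combination of both blocks and above by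
  -- `κ₊(k)²` on each block. The cross term is what remains.
  have key : ∀ α β : ℝ, -((kappaPlus X k ^ 2 - kappaMinus X (2 * k) ^ 2)
      * (α ^ 2 * a ^ 2 + β ^ 2 * c ^ 2)) ≤ 2 * (α * β * I) := by
    intro α β
    have h := kappaMinus_sq_mul_sum_le X D (2 * k) hk (A ∪ C)
      ((Finset.card_union_le _ _).trans (by omega))
      (fun i => (if i ∈ A then α else 0) + (if i ∈ C then β else 0))
      (fun j hj => by
        simp only [Finset.mem_union, not_or] at hj
        simp [hj.1, hj.2])
    rw [hsum, hquad] at h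
    have hA' := mul_le_mul_of_nonneg_left (hplus A hA) (sq_nonneg α)
    have hC' := mul_le_mul_of_nonneg_left (hplus C hC) (sq_nonneg β)
    rw [← hasq] at hA'
    rw [← hcsq] at hC'
    linarith
  have hvanish : ∀ T : Finset (Fin p), √(∑ i ∈ T, vecNorm (D.row i) ^ 2) = 0 →
      ∀ i ∈ T, D.row i = 0 := by
    intro T hT i hi
    have h1 := (Real.sqrt_eq_zero (Finset.sum_nonneg fun i _ => sq_nonneg _)).1 hT
    have h2 := (Finset.sum_eq_zero_iff_of_nonneg fun i _ => sq_nonneg _).1 h1 i hi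
    rw [vecNorm_sq] at h2
    exact dotProduct_self_eq_zero.1 h2
  rcases (Real.sqrt_nonneg _ : 0 ≤ a).eq_or_lt with h0 | h0
  · have : I = 0 := Finset.sum_eq_zero fun i hi => Finset.sum_eq_zero fun j _ => by
      simp [rowGram, hvanish A h0.symm i hi]
    rw [this, show a = 0 from h0.symm]; simp
  rcases (Real.sqrt_nonneg _ : 0 ≤ c).eq_or_lt with h1 | h1
  · have : I = 0 := Finset.sum_eq_zero fun i _ => Finset.sum_eq_zero fun j hj => by
      simp [rowGram, hvanish C h1.symm j hj]
    rw [this, show c = 0 from h1.symm]; simp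
  -- Weights `c` and `a` give both blocks the same norm `a * c`. The cases `a = 0` and `c = 0`,
  -- where no division is possible, were removed above.
  have h2 := key c a
  have h3 : (2 * (a * c)) * -((kappaPlus X k ^ 2 - kappaMinus X (2 * k) ^ 2) * a * c)
      ≤ (2 * (a * c)) * I := by linarith
  exact le_of_mul_le_mul_left h3 (by positivity)

/-! ### Deterministic error bound -/

theorem groupLasso_error_le {n p r : ℕ}
    (X : Matrix (Fin n) (Fin p) ℝ) (B : Matrix (Fin p) (Fin r) ℝ)
    (s : ℕ) (hs : 1 ≤ s) (hB : (rowSupport B).ncard ≤ s)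
    (lam : ℝ) (hlam : 0 < lam)
    (sStar : ℕ) (cStar K : ℝ) (hK : 1 < K)
    (hX : SparseEigenvalueCondition X sStar cStar K)
    (hsStar : 2 * s ≤ sStar)
    (hcStar : 6 * cStar ≤ √((sStar : ℝ) / (s : ℝ) - 1))
    (W : Matrix (Fin n) (Fin r) ℝ)
    (hW : ∀ j : Fin p, 2 * vecNorm (Matrix.vecMul (X.col j) (W - X * B)) ≤ lam)
    (Bhat : Matrix (Fin p) (Fin r) ℝ) (hBhat : IsGroupLasso X W lam Bhat) :
    ‖Bhat - B‖ ≤ 3 * (1 + (4 * cStar)⁻¹) / kappaMinus X sStar ^ 2 * √(s : ℝ) * lam := by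
  classical
  have hp := hX.two_mul_sStar_le
  have hκ : 0 < kappaMinus X sStar :=
    lt_of_lt_of_le (inv_pos.2 (by linarith)) hX.inv_K_le
  have hs0 : (0 : ℝ) < s := by exact_mod_cast hs
  have hθ : kappaPlus X sStar ^ 2 - kappaMinus X (2 * sStar) ^ 2
      ≤ kappaMinus X sStar ^ 2 * cStar := by
    have := hX.ratio_lt
    rw [div_lt_iff₀ (by positivity)] at this
    linarith
  have hBf : (rowSupport B).toFinset.card ≤ s := by
    rwa [← Set.ncard_eq_toFinset_card']
  -- The row support is padded to exactly `s` rows, so that `s_* = s + m` and `s_* / s - 1 = m / s`.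
  obtain ⟨S, hBS, -, hS⟩ := Finset.exists_subsuperset_card_eq
    (Finset.subset_univ (rowSupport B).toFinset) hBf (by simp; omega)
  have hrow : ∀ j ∉ S, B.row j = 0 := by
    intro j hj
    by_contra h
    exact hj (hBS (Set.mem_toFinset.2 h))
  obtain ⟨m, rfl⟩ : ∃ m, sStar = s + m := ⟨sStar - s, by omega⟩
  have hratio : ((s + m : ℕ) : ℝ) / s - 1 = (m : ℝ) / s := by
    push_cast; field_simp; ring
  rw [hratio] at hcStar
  -- Split `X * D` into the residual at `B` minus the residual at `Bhat`. The noise condition gives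
  -- `lam / 2`; optimality, tested by replacing row `j` of `Bhat` with that of `B`, gives the rest.
  have hopt : ∀ j, ∑ l, rowGram X (Bhat - B) j l
      ≤ lam / 2 * vecNorm ((Bhat - B).row j)
        + lam * (vecNorm (B.row j) - vecNorm (Bhat.row j)) := by
    intro j
    have h1 := hBhat.dotProduct_le hlam j (-(Bhat - B).row j)
    have h2 : Bhat.row j + -(Bhat - B).row j = B.row j := by
      ext k; simp
    rw [h2] at h1
    have h3 : X * (Bhat - B) = (W - X * B) - (W - X * Bhat) := by
      rw [Matrix.mul_sub]; abel
    have h4 := dotProduct_le_vecNorm_mul (Matrix.vecMul (X.col j) (W - X * B)) ((Bhat - B).row j)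
    have h5 := mul_le_mul_of_nonneg_right (hW j) (vecNorm_nonneg ((Bhat - B).row j))
    rw [sum_rowGram, h3, Matrix.vecMul_sub, sub_dotProduct]
    rw [dotProduct_neg] at h1
    linarith
  rw [Matrix.frobenius_norm_eq_sqrt_sum_vecNorm_sq]
  refine sqrt_sum_sq_le_of_restricted _ (fun i => vecNorm_nonneg _) (rowGram X (Bhat - B)) S s m hS
    hs (by omega) (by simp; omega) _ cStar lam (by positivity) hX.cStar_pos hlam hcStar ?_ ?_ ?_ ?_
    (sum_rowGram_nonneg _ _)
  · exact fun A hA => kappaMinus_sq_mul_sum_finset_le X _ _ (by omega) A hA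
  · intro A C hAC hA hC
    refine le_trans ?_ (neg_le_sum_sum_rowGram X _ _ hp A C hAC hA hC)
    have := Real.sqrt_nonneg (∑ i ∈ A, vecNorm ((Bhat - B).row i) ^ 2)
    have := Real.sqrt_nonneg (∑ i ∈ C, vecNorm ((Bhat - B).row i) ^ 2)
    rw [neg_le_neg_iff]
    gcongr
  · intro i _
    have h1 : vecNorm (B.row i) ≤ vecNorm (Bhat.row i) + vecNorm ((Bhat - B).row i) := by
      have h2 : B.row i = Bhat.row i + (-1 : ℝ) • (Bhat - B).row i := by
        ext k; simp
      rw [h2]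
      refine (vecNorm_add_le _ _).trans ?_
      rw [vecNorm_smul]; simp
    have := mul_le_mul_of_nonneg_left h1 hlam.le
    have := hopt i
    linarith
  · intro i hi
    have h1 : (Bhat - B).row i = Bhat.row i := by
      ext k; simpa using congrFun (hrow i hi) k
    have h2 : vecNorm (B.row i) = 0 := by rw [hrow i hi]; simp [vecNorm]
    have := hopt i
    rw [h1, h2] at this
    rw [h1]
    linarith

/-! ### Gaussian noise -/

/-- The density times `exp (u * x ^ 2)` is an unnormalised Gaussian with inverse variance `(1 - 2 *
u * v) / v`. -/
theorem mgf_sq_of_hasLaw_gaussianReal {Ω : Type*} [MeasurableSpace Ω] {μ : Measure Ω}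
    {Y : Ω → ℝ} {v : NNReal} (hv : v ≠ 0) (hY : HasLaw Y (gaussianReal 0 v) μ) (u : ℝ)
    (hu : 2 * u * v < 1) : mgf (fun ω => Y ω ^ 2) μ u = (√(1 - 2 * u * v))⁻¹ := by
  have hv0 : (0 : ℝ) < v := by exact_mod_cast pos_iff_ne_zero.2 hv
  have h1 := hY.integral_comp (f := fun x : ℝ => Real.exp (u * x ^ 2))
    (by fun_prop)
  rw [mgf]
  simp only [Function.comp_def] at h1
  rw [h1, integral_gaussianReal_eq_integral_smul hv]
  have h2 : ∀ x : ℝ, gaussianPDFReal 0 v x • Real.exp (u * x ^ 2)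
      = (√(2 * Real.pi * v))⁻¹ * Real.exp (-((1 - 2 * u * v) / (2 * v)) * x ^ 2) := by
    intro x
    rw [gaussianPDFReal, smul_eq_mul, mul_assoc, ← Real.exp_add]
    congr 2
    field_simp
    ring
  simp_rw [h2]
  rw [integral_const_mul, integral_gaussian, ← Real.sqrt_inv, ← Real.sqrt_inv,
    ← Real.sqrt_mul (by positivity)]
  congr 1
  have : 1 - 2 * u * v ≠ 0 := by linarith
  have := Real.pi_pos
  field_simp

/-- Tail bound for the Euclidean norm of a vector of `r` independent centred Gaussian variables. -/
theorem measureReal_sqrt_mul_le_vecNorm_le_exp {Ω : Type*} [MeasurableSpace Ω] {μ : Measure Ω}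
    [IsProbabilityMeasure μ] {r : ℕ} {Y : Fin r → Ω → ℝ} {v : NNReal} (hv : v ≠ 0)
    (hY : ∀ k, HasLaw (Y k) (gaussianReal 0 v) μ) (hind : iIndepFun Y μ) {t : ℝ} (ht : 0 < t) :
    μ.real {ω | √(v : ℝ) * (√(r : ℝ) + t) ≤ vecNorm (fun k => Y k ω)} ≤ Real.exp (-t ^ 2 / 2) := by
  have hv0 : (0 : ℝ) < v := by exact_mod_cast pos_iff_ne_zero.2 hv
  have hsv : 0 < √(v : ℝ) := Real.sqrt_pos.2 hv0
  rcases Nat.eq_zero_or_pos r with rfl | hr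
  · have : {ω | √(v : ℝ) * (√((0 : ℕ) : ℝ) + t) ≤ vecNorm (fun k => Y k ω)} = ∅ := by
      ext ω
      have : 0 < √(v : ℝ) * t := by positivity
      have h0 : vecNorm (fun k => Y k ω) = 0 := by
        rw [← sq_eq_zero_iff, vecNorm_sq]; simp [dotProduct]
      simpa [h0] using this
    rw [this]
    simpa using (Real.exp_pos _).le
  have hr0 : (0 : ℝ) < r := by exact_mod_cast hr
  have hsr : 0 < √(r : ℝ) := Real.sqrt_pos.2 hr0
  have hrsq : √(r : ℝ) ^ 2 = r := Real.sq_sqrt hr0.le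
  set a := √(r : ℝ) + t with ha
  have ha0 : 0 < a := by positivity
  -- The optimal Chernoff exponent, solving `1 - 2uv = r / a²`; each factor of the mgf becomes `a /
  -- √r`.
  set u := (1 - r / a ^ 2) / (2 * v) with hu
  have huv : 1 - 2 * u * v = r / a ^ 2 := by
    rw [hu]; field_simp; ring
  have hu0 : 0 ≤ u := by
    refine div_nonneg ?_ (by positivity)
    rw [sub_nonneg, div_le_one (by positivity), ← hrsq]
    exact pow_le_pow_left₀ hsr.le (by linarith) 2
  have hmgf : ∀ k, mgf (fun ω => Y k ω ^ 2) μ u = a / √r := by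
    intro k
    have : 0 < (r : ℝ) / a ^ 2 := by positivity
    rw [mgf_sq_of_hasLaw_gaussianReal hv (hY k) u (by linarith), huv, Real.sqrt_div hr0.le,
      Real.sqrt_sq ha0.le, inv_div]
  have hmeas : ∀ k, AEMeasurable (Y k) μ := fun k => (hY k).aemeasurable
  have hind2 : iIndepFun (fun k ω => Y k ω ^ 2) μ :=
    hind.comp (fun _ x => x ^ 2) fun _ => by fun_prop
  have hsum : mgf (∑ k, fun ω => Y k ω ^ 2) μ u = (a / √r) ^ r := by
    rw [hind2.mgf_sum₀ (fun k => (hmeas k).pow_const 2) Finset.univ, Finset.prod_congr rfl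
      fun k _ => hmgf k]
    simp [div_pow]
  -- The mgf defaults to zero when the exponential is not integrable, but here it is positive.
  have hint : Integrable (fun ω => Real.exp (u * (∑ k, fun ω => Y k ω ^ 2) ω)) μ := by
    by_contra h
    have h1 := mgf_undef h
    rw [hsum] at h1
    have : 0 < (a / √r) ^ r := by positivity
    exact this.ne' h1
  have hch := measure_ge_le_exp_mul_mgf (v * a ^ 2) hu0 hint
  rw [hsum] at hch
  have hset : {ω | √(v : ℝ) * a ≤ vecNorm (fun k => Y k ω)}
      ⊆ {ω | v * a ^ 2 ≤ (∑ k, fun ω => Y k ω ^ 2) ω} := by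
    intro ω hω
    have h1 := pow_le_pow_left₀ (by positivity) (Set.mem_ofPred_eq ▸ hω) 2
    rw [mul_pow, Real.sq_sqrt hv0.le, vecNorm_sq] at h1
    simpa [dotProduct, sq] using h1
  refine (measureReal_mono hset).trans (hch.trans ?_)
  -- Since `a / √r = 1 + t / √r`, this is `1 + x ≤ exp x`. It cancels the cross term of `(a ^ 2 - r)
  -- / 2 = t * √r + t ^ 2 / 2`.
  have h1 : (a / √r) ^ r ≤ Real.exp (t * √r) := by
    have h2 : a / √r ≤ Real.exp (t / √r) := by
      have := Real.add_one_le_exp (t / √r)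
      rw [ha, add_div, div_self hsr.ne']; linarith
    calc (a / √r) ^ r ≤ Real.exp (t / √r) ^ r := pow_le_pow_left₀ (by positivity) h2 r
      _ = Real.exp (t * √r) := by
        rw [← Real.exp_nat_mul]
        congr 1
        nth_rewrite 1 [← hrsq]
        field_simp
  calc Real.exp (-u * (v * a ^ 2)) * (a / √r) ^ r
      ≤ Real.exp (-u * (v * a ^ 2)) * Real.exp (t * √r) := by gcongr
    _ = Real.exp (-t ^ 2 / 2) := by
      rw [← Real.exp_add]
      congr 1
      have h3 : u * (v * a ^ 2) = (a ^ 2 - r) / 2 := by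
        rw [hu]; field_simp
      rw [neg_mul, h3, ha, ← hrsq, Real.sqrt_sq hsr.le]
      ring

theorem covariance_vecMul_gaussian {Ω : Type*} [MeasurableSpace Ω] {μ : Measure Ω}
    [IsProbabilityMeasure μ] {n r : ℕ} {Z : Ω → Matrix (Fin n) (Fin r) ℝ} {v : NNReal}
    (hind : iIndepFun (fun (ij : Fin n × Fin r) (ω : Ω) => Z ω ij.1 ij.2) μ)
    (hZ : ∀ i k, HasLaw (fun ω => Z ω i k) (gaussianReal 0 v) μ) (x : Fin n → ℝ) (k l : Fin r) :
    cov[fun ω => Matrix.vecMul x (Z ω) k, fun ω => Matrix.vecMul x (Z ω) l; μ]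
      = if k = l then v * (x ⬝ᵥ x) else 0 := by
  have hL2 : ∀ i k, MemLp (fun ω => Z ω i k) 2 μ := fun i k => (hZ i k).hasGaussianLaw.memLp_two
  have hcov : ∀ i j, cov[fun ω => Z ω i k, fun ω => Z ω j l; μ]
      = if i = j ∧ k = l then (v : ℝ) else 0 := by
    intro i j
    split_ifs with h
    · obtain ⟨rfl, rfl⟩ := h
      rw [covariance_self (hZ i k).aemeasurable, (hZ i k).variance_eq, variance_id_gaussianReal]
    · refine IndepFun.covariance_eq_zero ?_ (hL2 i k) (hL2 j l)
      exact hind.indepFun (i := (i, k)) (j := (j, l)) (by simpa using h)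
  simp only [Matrix.vecMul, dotProduct]
  rw [covariance_fun_sum_fun_sum (fun i => (hL2 i k).const_mul _) (fun i => (hL2 i l).const_mul _)]
  simp_rw [covariance_const_mul_left, covariance_const_mul_right, hcov]
  by_cases h : k = l
  · simp only [h, and_true, if_true, mul_ite, mul_zero, Finset.sum_ite_eq, Finset.mem_univ,
      Finset.mul_sum]
    exact Finset.sum_congr rfl fun _ _ => by ring
  · simp [h]

theorem hasGaussianLaw_vecMul {Ω : Type*} [MeasurableSpace Ω] {μ : Measure Ω}
    {n r : ℕ} {Z : Ω → Matrix (Fin n) (Fin r) ℝ} {v : NNReal}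
    (hind : iIndepFun (fun (ij : Fin n × Fin r) (ω : Ω) => Z ω ij.1 ij.2) μ)
    (hZ : ∀ i k, HasLaw (fun ω => Z ω i k) (gaussianReal 0 v) μ) (x : Fin n → ℝ) :
    HasGaussianLaw (fun ω k => Matrix.vecMul x (Z ω) k) μ := by
  have h := iIndepFun.hasGaussianLaw (fun ij : Fin n × Fin r => (hZ ij.1 ij.2).hasGaussianLaw) hind
  let L : (Fin n × Fin r → ℝ) →L[ℝ] (Fin r → ℝ) :=
    ContinuousLinearMap.pi fun k => ∑ i, x i • ContinuousLinearMap.proj (i, k)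
  have hL : (fun ω k => Matrix.vecMul x (Z ω) k) = fun ω => L fun ij => Z ω ij.1 ij.2 := by
    ext ω k
    simp [L, Matrix.vecMul, dotProduct]
  rw [hL]
  exact h.map_fun L

/-- The entries are jointly Gaussian, as a linear image of `Z`, so zero covariance yields
independence. -/
theorem iIndepFun_vecMul_gaussian {Ω : Type*} [MeasurableSpace Ω] {μ : Measure Ω}
    [IsProbabilityMeasure μ] {n r : ℕ} {Z : Ω → Matrix (Fin n) (Fin r) ℝ} {v : NNReal}
    (hind : iIndepFun (fun (ij : Fin n × Fin r) (ω : Ω) => Z ω ij.1 ij.2) μ)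
    (hZ : ∀ i k, HasLaw (fun ω => Z ω i k) (gaussianReal 0 v) μ) (x : Fin n → ℝ) :
    iIndepFun (fun k ω => Matrix.vecMul x (Z ω) k) μ :=
  (hasGaussianLaw_vecMul hind hZ x).iIndepFun_of_covariance_eq_zero fun k l hkl => by
    rw [covariance_vecMul_gaussian hind hZ, if_neg hkl]

theorem hasLaw_vecMul_gaussian {Ω : Type*} [MeasurableSpace Ω] {μ : Measure Ω}
    [IsProbabilityMeasure μ] {n r : ℕ} {Z : Ω → Matrix (Fin n) (Fin r) ℝ} {v : NNReal}
    (hind : iIndepFun (fun (ij : Fin n × Fin r) (ω : Ω) => Z ω ij.1 ij.2) μ)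
    (hZ : ∀ i k, HasLaw (fun ω => Z ω i k) (gaussianReal 0 v) μ) (x : Fin n → ℝ) (k : Fin r) :
    HasLaw (fun ω => Matrix.vecMul x (Z ω) k) (gaussianReal 0 (v * (x ⬝ᵥ x).toNNReal)) μ := by
  have hG : HasGaussianLaw (fun ω => Matrix.vecMul x (Z ω) k) μ :=
    (hasGaussianLaw_vecMul hind hZ x).map_fun (ContinuousLinearMap.proj k)
  refine ⟨hG.aemeasurable, ?_⟩
  rw [hG.map_eq_gaussianReal]
  congr 1
  · simp only [Matrix.vecMul, dotProduct]
    rw [integral_finsetSum _ fun i _ => (hZ i k).hasGaussianLaw.integrable.const_mul _]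
    refine Finset.sum_eq_zero fun i _ => ?_
    have := (hZ i k).integral_eq
    rw [integral_const_mul, this]
    simp
  · rw [← covariance_self hG.aemeasurable, covariance_vecMul_gaussian hind hZ, if_pos rfl,
      Real.toNNReal_mul v.coe_nonneg, Real.toNNReal_coe]

theorem measure_lt_two_mul_vecNorm_vecMul_le {Ω : Type*} [MeasurableSpace Ω] {μ : Measure Ω}
    [IsProbabilityMeasure μ] {n r : ℕ} {Z : Ω → Matrix (Fin n) (Fin r) ℝ} {σ : ℝ} (hσ : 0 ≤ σ)
    (hind : iIndepFun (fun (ij : Fin n × Fin r) (ω : Ω) => Z ω ij.1 ij.2) μ)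
    (hZ : ∀ i k, HasLaw (fun ω => Z ω i k) (gaussianReal 0 (σ ^ 2).toNNReal) μ) (x : Fin n → ℝ)
    {t lam : ℝ} (ht : 0 < t) (hlam : 0 < lam)
    (h : 2 * σ * vecNorm x * (√(r : ℝ) + t) ≤ lam) :
    μ {ω | lam < 2 * vecNorm (Matrix.vecMul x (Z ω))} ≤ ENNReal.ofReal (Real.exp (-t ^ 2 / 2)) := by
  have hlaw := hasLaw_vecMul_gaussian hind hZ x
  set v : NNReal := (σ ^ 2).toNNReal * (x ⬝ᵥ x).toNNReal with hv
  -- In the degenerate case (`σ = 0` or `x = 0`) the vector vanishes almost surely, and `0 < lam`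
  -- makes the event null.
  by_cases hv0 : v = 0
  · have hzero : ∀ᵐ ω ∂μ, ∀ k, Matrix.vecMul x (Z ω) k = 0 := by
      rw [ae_all_iff]
      intro k
      have h1 := hlaw k
      rw [hv0, gaussianReal_zero_var] at h1
      have h2 := h1.ae_iff (p := fun y => y = 0) (measurableSet_setOfPred.1 (measurableSet_singleton 0))
      rw [h2]
      simp
    have hnull : μ {ω | lam < 2 * vecNorm (Matrix.vecMul x (Z ω))} = 0 := by
      refine measure_mono_null ?_ (ae_iff.1 hzero)
      intro ω hω hall
      have h1 : Matrix.vecMul x (Z ω) = 0 := funext hall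
      simp only [Set.mem_ofPred_eq, h1] at hω
      simp [vecNorm] at hω
      linarith
    rw [hnull]
    exact zero_le
  · have hsv : √(v : ℝ) = σ * vecNorm x := by
      rw [hv, NNReal.coe_mul, Real.coe_toNNReal _ (sq_nonneg σ), ← vecNorm_sq,
        Real.coe_toNNReal _ (sq_nonneg _), ← mul_pow,
        Real.sqrt_sq (mul_nonneg hσ (vecNorm_nonneg x))]
    have h1 := measureReal_sqrt_mul_le_vecNorm_le_exp hv0 hlaw
      (iIndepFun_vecMul_gaussian hind hZ x) ht
    have h2 := ENNReal.ofReal_le_ofReal h1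
    rw [ofReal_measureReal] at h2
    refine (measure_mono fun ω hω => ?_).trans h2
    simp only [Set.mem_ofPred_eq] at hω ⊢
    rw [hsv]
    linarith

theorem exists_measurableSet_forall_two_mul_vecNorm_le {Ω : Type*} [MeasurableSpace Ω]
    {μ : Measure Ω} [IsProbabilityMeasure μ] {n p r : ℕ} (X : Matrix (Fin n) (Fin p) ℝ)
    {Z : Ω → Matrix (Fin n) (Fin r) ℝ} {σ η lam : ℝ} (hp : 0 < p) (hσ : 0 ≤ σ)
    (hind : iIndepFun (fun (ij : Fin n × Fin r) (ω : Ω) => Z ω ij.1 ij.2) μ)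
    (hZ : ∀ i k, HasLaw (fun ω => Z ω i k) (gaussianReal 0 (σ ^ 2).toNNReal) μ)
    (hη0 : 0 < η) (hη1 : η < 1) (hlam : 0 < lam)
    (h : 2 * σ * (⨆ j : Fin p, vecNorm (X.col j)) *
      (√(r : ℝ) + √(2 * Real.log ((p : ℝ) / η))) ≤ lam) :
    ∃ E : Set Ω, MeasurableSet E ∧ ENNReal.ofReal (1 - η) ≤ μ E ∧
      ∀ ω ∈ E, ∀ j, 2 * vecNorm (Matrix.vecMul (X.col j) (Z ω)) ≤ lam := by
  have hp1 : (1 : ℝ) ≤ p := by exact_mod_cast hp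
  have hlog : 0 < Real.log ((p : ℝ) / η) :=
    Real.log_pos ((one_lt_div hη0).2 (hη1.trans_le hp1))
  set t := √(2 * Real.log ((p : ℝ) / η)) with ht
  have ht0 : 0 < t := Real.sqrt_pos.2 (by positivity)
  -- The level `t` spends `η / p` on each column, so the union bound costs `η`.
  have hexp : Real.exp (-t ^ 2 / 2) = η / p := by
    rw [ht, Real.sq_sqrt (by positivity), show -(2 * Real.log ((p : ℝ) / η)) / 2
      = -Real.log ((p : ℝ) / η) by ring, Real.exp_neg, Real.exp_log (by positivity), inv_div]
  have hbad : ∀ j, μ {ω | lam < 2 * vecNorm (Matrix.vecMul (X.col j) (Z ω))}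
      ≤ ENNReal.ofReal (η / p) := by
    intro j
    rw [← hexp]
    refine measure_lt_two_mul_vecNorm_vecMul_le hσ hind hZ (X.col j) ht0 hlam (le_trans ?_ h)
    have : vecNorm (X.col j) ≤ ⨆ j : Fin p, vecNorm (X.col j) :=
      le_ciSup (f := fun j => vecNorm (X.col j)) (Set.finite_range _).bddAbove j
    gcongr
  set N := ⋃ j : Fin p, {ω | lam < 2 * vecNorm (Matrix.vecMul (X.col j) (Z ω))} with hN
  have hμN : μ N ≤ ENNReal.ofReal η := by
    calc μ N ≤ ∑ j : Fin p, μ {ω | lam < 2 * vecNorm (Matrix.vecMul (X.col j) (Z ω))} :=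
          measure_iUnion_fintype_le μ _
      _ ≤ ∑ j : Fin p, ENNReal.ofReal (η / p) := Finset.sum_le_sum fun j _ => hbad j
      _ = ENNReal.ofReal η := by
        rw [Finset.sum_const, Finset.card_univ, Fintype.card_fin, nsmul_eq_mul,
          ← ENNReal.ofReal_natCast, ← ENNReal.ofReal_mul (by positivity),
          mul_div_cancel₀ _ (by positivity)]
  -- The entries of `Z` are only almost everywhere measurable, so `N` is replaced by a measurable
  -- hull of equal measure.
  refine ⟨(toMeasurable μ N)ᶜ, (measurableSet_toMeasurable μ N).compl, ?_, ?_⟩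
  · rw [prob_compl_eq_one_sub (measurableSet_toMeasurable μ N), measure_toMeasurable,
      ENNReal.ofReal_sub _ hη0.le, ENNReal.ofReal_one]
    exact tsub_le_tsub_left hμN 1
  · intro ω hω j
    by_contra hj
    exact hω (subset_toMeasurable μ N (Set.mem_iUnion.2 ⟨j, not_le.1 hj⟩))

/-! ### The theorem -/

theorem theorem5 {n p r : ℕ}
    (X : Matrix (Fin n) (Fin p) ℝ) (B : Matrix (Fin p) (Fin r) ℝ)
    (s : ℕ) (hs : 1 ≤ s) (hB : (rowSupport B).ncard ≤ s)
    (lam : ℝ) (hlam : 0 < lam)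
    (sStar : ℕ) (cStar K : ℝ) (hK : 1 < K)
    (hX : SparseEigenvalueCondition X sStar cStar K)
    (hsStar : 2 * s ≤ sStar)
    (hcStar : 6 * cStar ≤ √((sStar : ℝ) / (s : ℝ) - 1)) :
    (∀ W : Matrix (Fin n) (Fin r) ℝ,
      (∀ j : Fin p, 2 * vecNorm (Matrix.vecMul (X.col j) (W - X * B)) ≤ lam) →
      ∀ Bhat : Matrix (Fin p) (Fin r) ℝ, IsGroupLasso X W lam Bhat →
        ‖Bhat - B‖ ≤ 3 * (1 + (4 * cStar)⁻¹) / kappaMinus X sStar ^ 2 * √(s : ℝ) * lam) ∧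
    (∀ (Ω : Type*) [MeasurableSpace Ω] (μ : Measure Ω) [IsProbabilityMeasure μ]
      (Z : Ω → Matrix (Fin n) (Fin r) ℝ) (σ : ℝ) (η : ℝ),
      0 ≤ σ →
      iIndepFun (fun (ij : Fin n × Fin r) (ω : Ω) => Z ω ij.1 ij.2) μ →
      (∀ (i : Fin n) (k : Fin r),
        HasLaw (fun ω => Z ω i k) (gaussianReal 0 (Real.toNNReal (σ ^ 2))) μ) →
      0 < η → η < 1 →
      2 * σ * (⨆ j : Fin p, vecNorm (X.col j)) *
        (√(r : ℝ) + √(2 * Real.log ((p : ℝ) / η))) ≤ lam →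
      ∃ E : Set Ω, MeasurableSet E ∧ ENNReal.ofReal (1 - η) ≤ μ E ∧
        ∀ ω ∈ E, ∀ Bhat : Matrix (Fin p) (Fin r) ℝ, IsGroupLasso X (X * B + Z ω) lam Bhat →
          ‖Bhat - B‖ ≤ 3 * (1 + (4 * cStar)⁻¹) / kappaMinus X sStar ^ 2 * √(s : ℝ) * lam) := by
  refine ⟨fun W hW Bhat hBhat => groupLasso_error_le X B s hs hB lam hlam sStar cStar K hK hX
    hsStar hcStar W hW Bhat hBhat, ?_⟩
  intro Ω _ μ _ Z σ η hσ hind hZ hη0 hη1 h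
  have hp : 0 < p := by
    have h1 := hX.sStar_pos
    have h2 := hX.two_mul_sStar_le
    omega
  -- The event controls the noise alone, so the bound holds on it for all minimisers at once.
  obtain ⟨E, hE, hμE, hEZ⟩ :=
    exists_measurableSet_forall_two_mul_vecNorm_le X hp hσ hind hZ hη0 hη1 hlam h
  refine ⟨E, hE, hμE, fun ω hω Bhat hBhat => groupLasso_error_le X B s hs hB lam hlam sStar cStar
    K hK hX hsStar hcStar (X * B + Z ω) (fun j => ?_) Bhat hBhat⟩
  rw [add_sub_cancel_left]
  exact hEZ ω hω j
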